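/- Let $M$ be a connected, finite-dimensional, complete (i.e. all geodesics are defined on $\mathbb{R}$) smooth Riemannian manifold with Riemannian distance $d$, and let $f : M \to \mathbb{R}$ be a differentiable function that attains its minimum; write $f^* = \min_M f$. Suppose that, for some $L > 0$, the gradient field of $f$ is $L$-Lipschitz in the sense that for all $p, q \in M$ and every geodesic segment $\gamma$ joining $p$ to $q$, $$\|P_{\gamma,p,q}\,\mathrm{grad} f(p) - \mathrm{grad} f(q)\| \le L\, d(p,q),$$ where $P_{\gamma,p,q}$ denotes parallel transport (for the Levi-Civita connection) along $\gamma$. Let $p_0 \in M$ and let $(p_k)$ be generated by the gradient method with constant stepsize $1/L$, i.e. $p_{k+1} = \exp_{p_k}\!\big(-\tfrac1L\,\mathrm{grad} f(p_k)\big)$ for all $k \ge 0$. Then for every $N \in \mathbb{N}$, $$\min\{\|\mathrm{grad} f(p_k)\| : k = 0, 1, \dots, N\} \le \frac{\sqrt{2L(f(p_0) - f^*)}}{\sqrt{N+1}}.$$ Consequently, for every $\varepsilon > 0$ there is a $k$ with $\|\mathrm{grad} f(p_k)\| < \varepsilon$, and the smallest such index $N$ (the number of iterations that the method needs) satisfies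 $N \le 2L(f(p_0)-f^*)/\varepsilon^2$; in particular it is $O\big(L(f(p_0)-f^*)/\varepsilon^2\big)$ with an absolute constant. -/

import Mathlib

open Bundle
open scoped Manifold ContDiff

noncomputable section

namespace RiemannianOpt

variable {E : Type*} [NormedAddCommGroup E] [NormedSpace ℝ E]
  {M : Type*} [TopologicalSpace M] [ChartedSpace E M]

/-- The velocity `γ'(t) ∈ T_{γ(t)} M` of a curve `γ : ℝ → M`. -/
def velocity (γ : ℝ → M) (t : ℝ) : TangentSpace 𝓘(ℝ, E) (γ t) :=
  mfderiv 𝓘(ℝ, ℝ) 𝓘(ℝ, E) γ t (1 : ℝ)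

/-- The components of a tangent vector `v ∈ T_x M` in the chart around `x₀`
(meaningful when `x` lies in the domain of that chart). -/
def coords (x₀ x : M) (v : TangentSpace 𝓘(ℝ, E) x) : E :=
  mfderiv 𝓘(ℝ, E) 𝓘(ℝ, E) (extChartAt 𝓘(ℝ, E) x₀) x v

variable [RiemannianBundle (fun x : M ↦ TangentSpace 𝓘(ℝ, E) x)]

/-- The Riemannian metric read in the chart around `x₀`: the bilinear form `g_y` on `E` whose
matrix is `(g_{ij}(y))`, for `y` in the image of the chart. -/
def chartMetric (x₀ : M) (y u w : E) : ℝ :=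
  inner ℝ
    (mfderiv 𝓘(ℝ, E) 𝓘(ℝ, E) (extChartAt 𝓘(ℝ, E) x₀).symm y u)
    (mfderiv 𝓘(ℝ, E) 𝓘(ℝ, E) (extChartAt 𝓘(ℝ, E) x₀).symm y w)

/-- The Christoffel symbols of the first kind of the Levi-Civita connection in the chart around
`x₀`, as a trilinear form:
`Γ_y(u, v; w) = (∂_u g(v, w) + ∂_v g(u, w) - ∂_w g(u, v)) / 2`. -/
def christoffel (x₀ : M) (y u v w : E) : ℝ :=
  (fderiv ℝ (fun z ↦ chartMetric x₀ z v w) y u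
    + fderiv ℝ (fun z ↦ chartMetric x₀ z u w) y v
    - fderiv ℝ (fun z ↦ chartMetric x₀ z u v) y w) / 2

/-- The vector field `V` along the curve `γ` is parallel on `s`, that is, `∇_{γ'} V = 0` on `s`
for the Levi-Civita connection `∇`: in every chart whose domain contains `γ t`, the components `ξ`
of `V` are differentiable at `t` and satisfy `ξ' + Γ(c', ξ) = 0`, where `c` is the curve
read in the chart; the index of this equation is lowered with the metric. -/
def IsParallelOn (γ : ℝ → M) (V : (t : ℝ) → TangentSpace 𝓘(ℝ, E) (γ t)) (s : Set ℝ) : Prop :=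
  ∀ t ∈ s, ∀ x₀ : M, γ t ∈ (extChartAt 𝓘(ℝ, E) x₀).source →
    ∃ ξ' : E, HasDerivWithinAt (fun r ↦ coords x₀ (γ r) (V r)) ξ' s t ∧
      ∀ w : E,
        chartMetric x₀ (extChartAt 𝓘(ℝ, E) x₀ (γ t)) ξ' w
          + christoffel x₀ (extChartAt 𝓘(ℝ, E) x₀ (γ t))
              (coords x₀ (γ t) (velocity γ t)) (coords x₀ (γ t) (V t)) w = 0

/-- A geodesic defined on all of `ℝ`: a smooth curve whose velocity field is parallel. -/
def IsGeodesic (γ : ℝ → M) : Prop :=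
  ContMDiff 𝓘(ℝ, ℝ) 𝓘(ℝ, E) ∞ γ ∧ IsParallelOn (E := E) γ (velocity γ) Set.univ

variable (E M) in
/-- Completeness: for all initial data, the geodesic is defined on all of `ℝ`. -/
def GeodesicallyComplete : Prop :=
  ∀ (p : M) (v : TangentSpace 𝓘(ℝ, E) p), ∃ γ : ℝ → M, IsGeodesic (E := E) γ ∧
    (⟨γ 0, velocity γ 0⟩ : TangentBundle 𝓘(ℝ, E) M) = ⟨p, v⟩

open Classical in
/-- The exponential map `exp_p v = γ(1)`, where `γ` is the geodesic with `γ(0) = p` and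
`γ'(0) = v` (the value is `p` if there is none defined on all of `ℝ`). -/
def expMap (p : M) (v : TangentSpace 𝓘(ℝ, E) p) : M :=
  if h : ∃ γ : ℝ → M, IsGeodesic (E := E) γ ∧
      (⟨γ 0, velocity γ 0⟩ : TangentBundle 𝓘(ℝ, E) M) = ⟨p, v⟩
  then h.choose 1 else p

open Classical in
/-- Parallel transport `T_{γ(a)} M → T_{γ(b)} M` along `γ` restricted to `[a, b]`: the value at `b`
of the parallel field along `γ` that starts at `v`. -/
def parallelTransport (γ : ℝ → M) (a b : ℝ) (v : TangentSpace 𝓘(ℝ, E) (γ a)) :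
    TangentSpace 𝓘(ℝ, E) (γ b) :=
  if h : ∃ V : (t : ℝ) → TangentSpace 𝓘(ℝ, E) (γ t),
      IsParallelOn γ V (Set.Icc a b) ∧ V a = v
  then h.choose b else 0

variable [FiniteDimensional ℝ E]

instance instFiniteDimensionalTangentSpace (x : M) :
    FiniteDimensional ℝ (TangentSpace 𝓘(ℝ, E) x) :=
  inferInstanceAs (FiniteDimensional ℝ E)

instance instCompleteSpaceTangentSpace (x : M) : CompleteSpace (TangentSpace 𝓘(ℝ, E) x) :=
  FiniteDimensional.complete ℝ _

/-- The Riemannian gradient: the vector representing the differential of `f` at `x`. -/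
def grad (f : M → ℝ) (x : M) : TangentSpace 𝓘(ℝ, E) x :=
  (InnerProductSpace.toDual ℝ (TangentSpace 𝓘(ℝ, E) x)).symm
    (mfderiv 𝓘(ℝ, E) 𝓘(ℝ, ℝ) f x)

theorem inner_grad (f : M → ℝ) (x : M) (v : TangentSpace 𝓘(ℝ, E) x) :
    inner ℝ (grad f x) v = mfderiv 𝓘(ℝ, E) 𝓘(ℝ, ℝ) f x v :=
  InnerProductSpace.toDual_symm_apply

/-- `p` is generated by the gradient method for `f` with stepsizes `τ k > 0`. -/
def IsGradientSequence (E : Type*) [NormedAddCommGroup E] [NormedSpace ℝ E]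
    [FiniteDimensional ℝ E] {M : Type*} [TopologicalSpace M] [ChartedSpace E M]
    [RiemannianBundle (fun x : M ↦ TangentSpace 𝓘(ℝ, E) x)]
    (f : M → ℝ) (τ : ℕ → ℝ) (p : ℕ → M) : Prop :=
  ∀ k : ℕ, 0 < τ k ∧ p (k + 1) = expMap (E := E) (p k) (-(τ k) • grad f (p k))

/-- The gradient field of `f` is Lipschitz continuous with constant `L`: for every geodesic
segment `γ : [a, b] → M` from `p = γ(a)` to `q = γ(b)`,
`‖P_{γ,p,q} grad f(p) - grad f(q)‖ ≤ L d(p, q)`. -/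
def HasLipschitzGradient (E : Type*) [NormedAddCommGroup E] [NormedSpace ℝ E]
    [FiniteDimensional ℝ E] {M : Type*} [MetricSpace M] [ChartedSpace E M]
    [RiemannianBundle (fun x : M ↦ TangentSpace 𝓘(ℝ, E) x)]
    (f : M → ℝ) (L : ℝ) : Prop :=
  ∀ γ : ℝ → M, IsGeodesic (E := E) γ → ∀ a b : ℝ, a ≤ b →
    ‖parallelTransport (E := E) γ a b (grad f (γ a)) - grad f (γ b)‖ ≤ L * dist (γ a) (γ b)

end RiemannianOpt

end

/-! Everything rests on the descent inequality `apply_expMap_le`: `f (exp_p v) ≤ f p + ⟨grad f p, v⟩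
+ L‖v‖²/2`. At `v = -grad f p / L` it gives `‖grad f (p k)‖² ≤ 2L (f (p k) - f (p (k+1)))`
(`gradient_step_le`). The right-hand sides telescope, so all partial sums of the squared gradient
norms are at most `2L (f (p 0) - fstar)`, and both claims follow by counting terms.

For the descent inequality let `ψ = ⟨grad f, γ'⟩ = (f ∘ γ)'` along a geodesic `γ`. Parallel fields
have constant inner products and `γ'` is parallel, so `ψ b - ψ a = ⟨grad f (γ b) - P grad f (γ a),
γ' b⟩`. The Lipschitz hypothesis, Cauchy-Schwarz and constant speed bound this by `L‖γ'‖²(b - a)`; a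
comparison argument on `[0, 1]` finishes.

The delicate point is that `parallelTransport` is `0` unless a parallel field exists. Existence is
shown only on short intervals (`exists_isParallelOn_nhds`), by a linear ODE in one chart and the
transformation law of the Christoffel symbols. This suffices, since a bound on local slopes of `ψ`
propagates to all `t ≥ 0`. -/

noncomputable section

namespace RiemannianOpt

variable {E : Type*} [NormedAddCommGroup E] [NormedSpace ℝ E]
  {M : Type*} [TopologicalSpace M] [ChartedSpace E M]

/-! ### Charts and the metric in coordinates. -/

section Charts

variable [IsManifold 𝓘(ℝ, E) ∞ M]

theorem mfderiv_chart_symm_coords {x₀ x : M} (hx : x ∈ (extChartAt 𝓘(ℝ, E) x₀).source)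
    (v : TangentSpace 𝓘(ℝ, E) x) :
    mfderiv 𝓘(ℝ, E) 𝓘(ℝ, E) (extChartAt 𝓘(ℝ, E) x₀).symm (extChartAt 𝓘(ℝ, E) x₀ x)
      (coords (E := E) x₀ x v) = (v : E) := by
  have h := mfderivWithin_extChartAt_symm_comp_mfderiv_extChartAt' (I := 𝓘(ℝ, E)) hx
  have hr : Set.range (𝓘(ℝ, E) : E → E) = Set.univ := by simp
  rw [hr, mfderivWithin_univ] at h
  exact DFunLike.congr_fun h v

theorem coords_mfderiv_chart_symm {x₀ x : M} (hx : x ∈ (extChartAt 𝓘(ℝ, E) x₀).source) (u : E) :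
    coords x₀ x (mfderiv 𝓘(ℝ, E) 𝓘(ℝ, E) (extChartAt 𝓘(ℝ, E) x₀).symm
      (extChartAt 𝓘(ℝ, E) x₀ x) u : E) = u := by
  have h := mfderiv_extChartAt_comp_mfderivWithin_extChartAt_symm' (I := 𝓘(ℝ, E)) hx
  have hr : Set.range (𝓘(ℝ, E) : E → E) = Set.univ := by simp
  rw [hr, mfderivWithin_univ] at h
  exact DFunLike.congr_fun h u

/-- The coordinate field of `u` is the tangent map of the inverse chart applied to a constant
section. Its smoothness makes the `g_ij` smooth in `contDiffOn_metricForm`. -/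
theorem contMDiffOn_mfderiv_chart_symm (x₀ : M) (u : E) :
    ContMDiffOn 𝓘(ℝ, E) 𝓘(ℝ, E).tangent ∞
      (fun z ↦ (⟨(extChartAt 𝓘(ℝ, E) x₀).symm z,
        mfderiv 𝓘(ℝ, E) 𝓘(ℝ, E) (extChartAt 𝓘(ℝ, E) x₀).symm z u⟩ : TangentBundle 𝓘(ℝ, E) M))
      (extChartAt 𝓘(ℝ, E) x₀).target := by
  have h1 : ContMDiffOn 𝓘(ℝ, E) 𝓘(ℝ, E) ∞ (extChartAt 𝓘(ℝ, E) x₀).symm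
      (extChartAt 𝓘(ℝ, E) x₀).target := contMDiffOn_extChartAt_symm x₀
  have h2 := h1.contMDiffOn_tangentMapWithin (m := ∞) (by simp)
    (isOpen_extChartAt_target x₀).uniqueMDiffOn
  have h3 : ContMDiff 𝓘(ℝ, E) 𝓘(ℝ, E).tangent ∞
      (fun z : E ↦ (⟨z, u⟩ : TangentBundle 𝓘(ℝ, E) E)) := by
    intro z
    rw [contMDiffAt_totalSpace]
    refine ⟨contMDiffAt_id, ?_⟩
    simpa using! contMDiffAt_const
  have h4 := h2.comp h3.contMDiffOn (s := (extChartAt 𝓘(ℝ, E) x₀).target) (fun z hz ↦ hz)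
  refine h4.congr fun z hz ↦ ?_
  simp only [tangentMapWithin, Function.comp]
  rw [mfderivWithin_of_isOpen (isOpen_extChartAt_target x₀) hz]

end Charts

variable [RiemannianBundle (fun x : M ↦ TangentSpace 𝓘(ℝ, E) x)]

/-- The metric read in the chart around `x₀`, as a continuous bilinear form on `E`. -/
def metricForm (x₀ : M) (y : E) : E →L[ℝ] E →L[ℝ] ℝ :=
  (innerSL ℝ (E := TangentSpace 𝓘(ℝ, E) ((extChartAt 𝓘(ℝ, E) x₀).symm y))).bilinearComp
    (mfderiv 𝓘(ℝ, E) 𝓘(ℝ, E) (extChartAt 𝓘(ℝ, E) x₀).symm y)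
    (mfderiv 𝓘(ℝ, E) 𝓘(ℝ, E) (extChartAt 𝓘(ℝ, E) x₀).symm y)

theorem metricForm_apply (x₀ : M) (y u w : E) : metricForm x₀ y u w = chartMetric x₀ y u w := rfl

theorem metricForm_symm (x₀ : M) (y u w : E) : metricForm x₀ y u w = metricForm x₀ y w u :=
  real_inner_comm (mfderiv 𝓘(ℝ, E) 𝓘(ℝ, E) (extChartAt 𝓘(ℝ, E) x₀).symm y w)
    (mfderiv 𝓘(ℝ, E) 𝓘(ℝ, E) (extChartAt 𝓘(ℝ, E) x₀).symm y u)

theorem inner_eq_metricForm [IsManifold 𝓘(ℝ, E) ∞ M] {x₀ x : M}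
    (hx : x ∈ (extChartAt 𝓘(ℝ, E) x₀).source)
    (v w : TangentSpace 𝓘(ℝ, E) x) :
    inner ℝ v w = metricForm x₀ (extChartAt 𝓘(ℝ, E) x₀ x) (coords x₀ x v) (coords x₀ x w) := by
  have hx' := (extChartAt 𝓘(ℝ, E) x₀).left_inv hx
  -- The chart form takes its inner product in the fibre over `symm (chart x)`, which equals `x`
  -- only propositionally; `key` moves the inner product between the two fibres.
  have key : ∀ x' : M, x' = x → ∀ a b : TangentSpace 𝓘(ℝ, E) x', @Eq E a v → @Eq E b w →
      inner ℝ v w = inner ℝ a b := by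
    rintro x' rfl a b rfl rfl
    rfl
  exact key _ hx' _ _ (mfderiv_chart_symm_coords hx v) (mfderiv_chart_symm_coords hx w)

variable [FiniteDimensional ℝ E] [IsManifold 𝓘(ℝ, E) ∞ M]

/-- Positive definiteness and injectivity of the inverse chart's differential give injectivity;
dimensions agree. This allows the parallel equation to be solved for `ξ'`. -/
theorem isInvertible_metricForm {x₀ : M} {y : E} (hy : y ∈ (extChartAt 𝓘(ℝ, E) x₀).target) :
    (metricForm x₀ y).IsInvertible := by
  have hinj : Function.Injective (metricForm x₀ y : E →ₗ[ℝ] E →L[ℝ] ℝ) := by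
    rw [← LinearMap.ker_eq_bot, LinearMap.ker_eq_bot']
    intro u hu
    have h1 : metricForm x₀ y u u = 0 := by
      have := DFunLike.congr_fun hu u
      simpa using this
    have h2 : mfderiv 𝓘(ℝ, E) 𝓘(ℝ, E) (extChartAt 𝓘(ℝ, E) x₀).symm y u = 0 :=
      inner_self_eq_zero.1 h1
    have h3 := coords_mfderiv_chart_symm ((extChartAt 𝓘(ℝ, E) x₀).map_target hy) u
    rw [(extChartAt 𝓘(ℝ, E) x₀).right_inv hy] at h3
    rw [← h3]
    rw [show coords x₀ _ (mfderiv 𝓘(ℝ, E) 𝓘(ℝ, E) (extChartAt 𝓘(ℝ, E) x₀).symm y u) =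
      coords x₀ _ 0 from congrArg (coords x₀ ((extChartAt 𝓘(ℝ, E) x₀).symm y)) h2]
    exact map_zero (mfderiv 𝓘(ℝ, E) 𝓘(ℝ, E) (extChartAt 𝓘(ℝ, E) x₀) _)
  have hfin : Module.finrank ℝ E = Module.finrank ℝ (E →L[ℝ] ℝ) := by
    rw [← (LinearMap.toContinuousLinearMap (𝕜 := ℝ) (E := E) (F' := ℝ)).finrank_eq]
    exact (Subspace.dual_finrank_eq).symm
  refine ⟨(LinearEquiv.ofInjectiveOfFinrankEq _ hinj hfin).toContinuousLinearEquiv, ?_⟩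
  ext u w
  rfl

variable [IsContMDiffRiemannianBundle 𝓘(ℝ, E) ∞ E (fun x : M ↦ TangentSpace 𝓘(ℝ, E) x)]

theorem contDiffOn_metricForm (x₀ : M) :
    ContDiffOn ℝ ∞ (metricForm (E := E) x₀) (extChartAt 𝓘(ℝ, E) x₀).target := by
  rw [contDiffOn_clm_apply]
  intro u
  rw [contDiffOn_clm_apply]
  intro w
  rw [← contMDiffOn_iff_contDiffOn]
  exact ContMDiffOn.inner_bundle (F := E) (E := fun x : M ↦ TangentSpace 𝓘(ℝ, E) x)
    (contMDiffOn_mfderiv_chart_symm x₀ u) (contMDiffOn_mfderiv_chart_symm x₀ w)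

end RiemannianOpt

end

noncomputable section

namespace RiemannianOpt

set_option maxSynthPendingDepth 3

/-! ### Christoffel symbols and the parallel equation in a vector space. -/

section Calculus

open Filter Topology Set

variable {F : Type*} [NormedAddCommGroup F] [NormedSpace ℝ F]

/-- The Christoffel symbols of the first kind of a field of bilinear forms on a vector space. -/
def christoffelForm (G : F → F →L[ℝ] F →L[ℝ] ℝ) (y u v w : F) : ℝ :=
  (fderiv ℝ G y u v w + fderiv ℝ G y v u w - fderiv ℝ G y w u v) / 2

/-- The equation `∇_u ξ = 0` at `y`, where `ξ'` is the derivative of the components of `ξ`. -/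
def ParallelEq (G : F → F →L[ℝ] F →L[ℝ] ℝ) (y u ξ ξ' : F) : Prop :=
  ∀ w, G y ξ' w + christoffelForm G y u ξ w = 0

theorem fderiv_bilin_symm {G : F → F →L[ℝ] F →L[ℝ] ℝ} {y : F}
    (hG : DifferentiableAt ℝ G y) (hsymm : ∀ z u w, G z u w = G z w u) (u v w : F) :
    fderiv ℝ G y u v w = fderiv ℝ G y u w v := by
  have h (a b : F) : HasFDerivAt (fun z ↦ G z a b) (((fderiv ℝ G y).flip a).flip b) y := by
    simpa using! (hG.hasFDerivAt.clm_apply (hasFDerivAt_const a y)).clm_apply (hasFDerivAt_const b y)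
  have h1 := h v w
  have h2 := h w v
  simp only [hsymm _ v w] at h1
  exact DFunLike.congr_fun (h1.unique h2) u

theorem fderiv_pullback_bilin {G H : F → F →L[ℝ] F →L[ℝ] ℝ} {φ : F → F} {y : F}
    (hG : DifferentiableAt ℝ G y) (hH : DifferentiableAt ℝ H (φ y)) (hφ : ContDiffAt ℝ 2 φ y)
    (h : ∀ᶠ z in 𝓝 y, ∀ u w, G z u w = H (φ z) (fderiv ℝ φ z u) (fderiv ℝ φ z w)) (a b c : F) :
    fderiv ℝ G y a b c =
      fderiv ℝ H (φ y) (fderiv ℝ φ y a) (fderiv ℝ φ y b) (fderiv ℝ φ y c)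
        + H (φ y) (fderiv ℝ (fderiv ℝ φ) y a b) (fderiv ℝ φ y c)
        + H (φ y) (fderiv ℝ φ y b) (fderiv ℝ (fderiv ℝ φ) y a c) := by
  have h1 : HasFDerivAt (fun z ↦ G z b c) (((fderiv ℝ G y).flip b).flip c) y := by
    simpa using! (hG.hasFDerivAt.clm_apply (hasFDerivAt_const b y)).clm_apply (hasFDerivAt_const c y)
  have hφ1 : HasFDerivAt φ (fderiv ℝ φ y) y := (hφ.differentiableAt (by simp)).hasFDerivAt
  have hφ2 : HasFDerivAt (fderiv ℝ φ) (fderiv ℝ (fderiv ℝ φ) y) y :=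
    ((hφ.fderiv_right (m := 1) (by norm_num)).differentiableAt (by simp)).hasFDerivAt
  have h2 := ((hH.hasFDerivAt.comp y hφ1).clm_apply
    (hφ2.clm_apply (hasFDerivAt_const b y))).clm_apply (hφ2.clm_apply (hasFDerivAt_const c y))
  have h3 : HasFDerivAt (fun z ↦ G z b c) _ y :=
    h2.congr_of_eventuallyEq (h.mono fun z hz ↦ hz b c)
  have := DFunLike.congr_fun (h1.unique h3) a
  simp at this
  rw [this]
  ring

/-- Of the six terms containing `D²φ`, four cancel by the symmetry of `D²φ` and of `H`; the other
two coincide and absorb the factor `1/2`. -/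
theorem christoffelForm_pullback {G H : F → F →L[ℝ] F →L[ℝ] ℝ} {φ : F → F} {y : F}
    (hG : DifferentiableAt ℝ G y) (hH : DifferentiableAt ℝ H (φ y)) (hφ : ContDiffAt ℝ 2 φ y)
    (hsymm : ∀ z u w, H z u w = H z w u)
    (h : ∀ᶠ z in 𝓝 y, ∀ u w, G z u w = H (φ z) (fderiv ℝ φ z u) (fderiv ℝ φ z w)) (u v w : F) :
    christoffelForm G y u v w =
      christoffelForm H (φ y) (fderiv ℝ φ y u) (fderiv ℝ φ y v) (fderiv ℝ φ y w)
        + H (φ y) (fderiv ℝ (fderiv ℝ φ) y u v) (fderiv ℝ φ y w) := by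
  have hs := (hφ.isSymmSndFDerivAt (by simp [minSmoothness_of_isRCLikeNormedField])).eq
  simp only [christoffelForm, fderiv_pullback_bilin hG hH hφ h]
  rw [hs v u, hs w u, hs w v, hsymm (φ y) (fderiv ℝ φ y u) (fderiv ℝ (fderiv ℝ φ) y v w),
    hsymm (φ y) (fderiv ℝ φ y v) (fderiv ℝ (fderiv ℝ φ) y u w)]
  rw [hsymm (φ y) (fderiv ℝ (fderiv ℝ φ) y v w)]
  ring

/-- The inhomogeneous term in the law for the Christoffel symbols is exactly the `D²φ u ξ` produced
by differentiating `Dφ(c) ξ`. -/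
theorem ParallelEq.pushforward {G H : F → F →L[ℝ] F →L[ℝ] ℝ} {φ : F → F} {y u ξ ξ' : F}
    (hG : DifferentiableAt ℝ G y) (hH : DifferentiableAt ℝ H (φ y)) (hφ : ContDiffAt ℝ 2 φ y)
    (hsymm : ∀ z u w, H z u w = H z w u)
    (h : ∀ᶠ z in 𝓝 y, ∀ u w, G z u w = H (φ z) (fderiv ℝ φ z u) (fderiv ℝ φ z w))
    (hsurj : Function.Surjective (fderiv ℝ φ y)) (hξ : ParallelEq G y u ξ ξ') :
    ParallelEq H (φ y) (fderiv ℝ φ y u) (fderiv ℝ φ y ξ)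
      (fderiv ℝ (fderiv ℝ φ) y u ξ + fderiv ℝ φ y ξ') := by
  intro w
  obtain ⟨w, rfl⟩ := hsurj w
  have h1 := hξ w
  rw [christoffelForm_pullback hG hH hφ hsymm h, h.self_of_nhds] at h1
  simp only [map_add, add_apply]
  linarith

theorem hasDerivWithinAt_pushforward {φ : F → F} {c ξ : ℝ → F} {c' ξ' : F} {s : Set ℝ} {t : ℝ}
    (hφ : ContDiffAt ℝ 2 φ (c t)) (hc : HasDerivWithinAt c c' s t)
    (hξ : HasDerivWithinAt ξ ξ' s t) :
    HasDerivWithinAt (fun r ↦ fderiv ℝ φ (c r) (ξ r))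
      (fderiv ℝ (fderiv ℝ φ) (c t) c' (ξ t) + fderiv ℝ φ (c t) ξ') s t := by
  have hφ2 : HasFDerivAt (fderiv ℝ φ) (fderiv ℝ (fderiv ℝ φ) (c t)) (c t) :=
    ((hφ.fderiv_right (m := 1) (by norm_num)).differentiableAt (by simp)).hasFDerivAt
  exact (hφ2.comp_hasDerivWithinAt t hc).clm_apply hξ

/-- Metric compatibility: `Γ(u, ξ; η) + Γ(u, η; ξ) = ∂_u G(ξ, η)`, which cancels the derivatives of
`ξ` and `η`. -/
theorem ParallelEq.hasDerivWithinAt_bilin {G : F → F →L[ℝ] F →L[ℝ] ℝ} {c ξ η : ℝ → F}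
    {c' ξ' η' : F} {s : Set ℝ} {t : ℝ} (hG : DifferentiableAt ℝ G (c t))
    (hsymm : ∀ z u w, G z u w = G z w u)
    (hc : HasDerivWithinAt c c' s t) (hξ : HasDerivWithinAt ξ ξ' s t)
    (hη : HasDerivWithinAt η η' s t) (hξe : ParallelEq G (c t) c' (ξ t) ξ')
    (hηe : ParallelEq G (c t) c' (η t) η') :
    HasDerivWithinAt (fun r ↦ G (c r) (ξ r) (η r)) 0 s t := by
  have h := ((hG.hasFDerivAt.comp_hasDerivWithinAt t hc).clm_apply hξ).clm_apply hη
  convert! h using 1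
  have h1 := hξe (η t)
  have h2 := hηe (ξ t)
  rw [hsymm (c t) η'] at h2
  simp only [christoffelForm] at h1 h2
  rw [fderiv_bilin_symm hG hsymm c' (η t) (ξ t)] at h2
  rw [fderiv_bilin_symm hG hsymm (η t) c' (ξ t)] at h2
  rw [fderiv_bilin_symm hG hsymm (η t) c' (ξ t)] at h1
  rw [fderiv_bilin_symm hG hsymm (ξ t) c' (η t)] at h1 h2
  simp only [Function.comp, add_apply]
  linarith

/-- Picard-Lindelöf on the ball of radius `‖x‖` about `x`: there the field is at most `2K‖x‖`, so a
time of at most `1/(2K)` cannot leave the ball. -/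
theorem exists_linearODE_solution [CompleteSpace F] {A : ℝ → F →L[ℝ] F} {a b K : ℝ} (hab : a ≤ b)
    (hA : ContinuousOn A (Icc a b)) (hK : ∀ t ∈ Icc a b, ‖A t‖ ≤ K) (hKab : K * (b - a) ≤ 1 / 2)
    (x : F) :
    ∃ ξ : ℝ → F, ξ a = x ∧ ∀ t ∈ Icc a b, HasDerivWithinAt ξ (A t (ξ t)) (Icc a b) t := by
  have hK0 : 0 ≤ K := (norm_nonneg _).trans (hK a (left_mem_Icc.2 hab))
  have hp : IsPicardLindelof (fun t y ↦ A t y) (⟨a, left_mem_Icc.2 hab⟩ : Icc a b) x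
      ‖x‖₊ 0 (K.toNNReal * (2 * ‖x‖₊)) K.toNNReal := by
    refine ⟨fun t ht ↦ ?_, fun y _ ↦ hA.clm_apply continuousOn_const, fun t ht y hy ↦ ?_, ?_⟩
    · refine ((A t).lipschitz.weaken ?_).lipschitzOnWith
      rw [← NNReal.coe_le_coe, Real.coe_toNNReal _ hK0]
      exact hK t ht
    · have hy' : ‖y‖ ≤ 2 * ‖x‖ := by
        rw [Metric.mem_closedBall, dist_eq_norm] at hy
        have := norm_sub_norm_le y x
        simp at hy
        linarith
      simp only [NNReal.coe_mul, Real.coe_toNNReal _ hK0, NNReal.coe_ofNat, coe_nnnorm]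
      exact ((A t).le_opNorm y).trans (mul_le_mul (hK t ht) hy' (norm_nonneg _) hK0)
    · simp only [NNReal.coe_mul, Real.coe_toNNReal _ hK0, NNReal.coe_ofNat, coe_nnnorm, sub_self,
        NNReal.coe_zero, sub_zero]
      rw [max_eq_left (by linarith)]
      nlinarith [norm_nonneg x]
  exact hp.exists_eq_forall_mem_Icc_hasDerivWithinAt₀

/-- The bilinear form `(v, w) ↦ Γ_y(u, v; w)`. -/
def christoffelBilin (D : F →L[ℝ] F →L[ℝ] F →L[ℝ] ℝ) (u : F) : F →L[ℝ] F →L[ℝ] ℝ :=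
  (2⁻¹ : ℝ) • (D u + D.flip u - (D.flip u).flip)

theorem christoffelBilin_apply (G : F → F →L[ℝ] F →L[ℝ] ℝ) (y u v w : F) :
    christoffelBilin (fderiv ℝ G y) u v w = christoffelForm G y u v w := by
  simp [christoffelBilin, christoffelForm]
  ring

theorem continuousOn_christoffelBilin {X : Type*} [TopologicalSpace X]
    {D : X → F →L[ℝ] F →L[ℝ] F →L[ℝ] ℝ} {u : X → F} {s : Set X} (hD : ContinuousOn D s)
    (hu : ContinuousOn u s) : ContinuousOn (fun x ↦ christoffelBilin (D x) (u x)) s := by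
  have h1 : ContinuousOn (fun x ↦ (D x).flip (u x)) s :=
    ((ContinuousLinearMap.flipₗᵢ ℝ F F (F →L[ℝ] ℝ)).continuous.comp_continuousOn hD).clm_apply hu
  have h2 : ContinuousOn (fun x ↦ ((D x).flip (u x)).flip) s :=
    (ContinuousLinearMap.flipₗᵢ ℝ F F ℝ).continuous.comp_continuousOn h1
  have h3 : ContinuousOn (fun x ↦ D x (u x)) s := hD.clm_apply hu
  exact ((h3.add h1).sub h2).const_smul (2⁻¹ : ℝ)

theorem continuousOn_clm_inverse {X F' : Type*} [TopologicalSpace X] [NormedAddCommGroup F']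
    [NormedSpace ℝ F'] [CompleteSpace F] {B : X → F →L[ℝ] F'} {s : Set X} (hB : ContinuousOn B s)
    (hinv : ∀ t ∈ s, (B t).IsInvertible) : ContinuousOn (fun t ↦ (B t).inverse) s := by
  intro t ht
  have h : ContinuousAt ContinuousLinearMap.inverse (B t) :=
    ((hinv t ht).contDiffAt_map_inverse (n := 0)).continuousAt
  exact ContinuousAt.comp_continuousWithinAt h (hB t ht)

/-- The endomorphism `v ↦ -Γ_y(u, v)`, with the Christoffel symbols of the second kind. -/
def christoffelEnd (G : F → F →L[ℝ] F →L[ℝ] ℝ) (y u : F) : F →L[ℝ] F :=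
  -((G y).inverse ∘L christoffelBilin (fderiv ℝ G y) u)

theorem parallelEq_christoffelEnd {G : F → F →L[ℝ] F →L[ℝ] ℝ} {y : F}
    (hinv : (G y).IsInvertible) (u ξ : F) : ParallelEq G y u ξ (christoffelEnd G y u ξ) := by
  intro w
  have h : G y (christoffelEnd G y u ξ) = -(christoffelBilin (fderiv ℝ G y) u ξ) := by
    simp only [christoffelEnd, neg_apply, ContinuousLinearMap.comp_apply, map_neg]
    congr 1
    exact (hinv.inverse_apply_eq.1 rfl).symm
  rw [h, neg_apply, christoffelBilin_apply]
  ring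

theorem continuousOn_christoffelEnd [CompleteSpace F] {G : F → F →L[ℝ] F →L[ℝ] ℝ} {U : Set F}
    (hU : IsOpen U) (hG : ContDiffOn ℝ 1 G U) (hinv : ∀ y ∈ U, (G y).IsInvertible)
    {c c' : ℝ → F} {s : Set ℝ} (hcU : MapsTo c s U)
    (hc : ContinuousOn c s) (hc' : ContinuousOn c' s) :
    ContinuousOn (fun t ↦ christoffelEnd G (c t) (c' t)) s := by
  have hGc : ContinuousOn (fun t ↦ G (c t)) s := hG.continuousOn.comp hc hcU
  have h1 : ContinuousOn (fun t ↦ (G (c t)).inverse) s :=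
    continuousOn_clm_inverse hGc fun t ht ↦ hinv (c t) (hcU ht)
  have hD : ContinuousOn (fun t ↦ fderiv ℝ G (c t)) s :=
    (hG.continuousOn_fderiv_of_isOpen hU le_rfl).comp hc hcU
  have h2 : ContinuousOn (fun t ↦ christoffelBilin (fderiv ℝ G (c t)) (c' t)) s :=
    continuousOn_christoffelBilin hD hc'
  exact (h1.clm_comp h2).neg

theorem exists_local_parallel [CompleteSpace F] {G : F → F →L[ℝ] F →L[ℝ] ℝ} {U : Set F}
    (hU : IsOpen U) (hG : ContDiffOn ℝ 1 G U) (hinv : ∀ y ∈ U, (G y).IsInvertible)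
    {c c' : ℝ → F} {t₀ : ℝ} {s : Set ℝ} (hs : s ∈ 𝓝 t₀) (hcU : MapsTo c s U)
    (hc : ContinuousOn c s) (hc' : ContinuousOn c' s) :
    ∃ δ > 0, ∀ a b, t₀ - δ < a → a ≤ b → b < t₀ + δ → ∀ x : F, ∃ ξ : ℝ → F, ξ a = x ∧
      ∀ t ∈ Icc a b, ∃ ξ' : F, HasDerivWithinAt ξ ξ' (Icc a b) t ∧
        ParallelEq G (c t) (c' t) (ξ t) ξ' := by
  have hA := continuousOn_christoffelEnd hU hG hinv hcU hc hc'
  generalize hAdef : (fun t ↦ christoffelEnd G (c t) (c' t)) = A at hA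
  have ht₀ : t₀ ∈ s := mem_of_mem_nhds hs
  set K := ‖A t₀‖ + 1
  have hev : ∀ᶠ t in 𝓝 t₀, t ∈ s ∧ ‖A t‖ < K :=
    Filter.Eventually.and hs ((((hA t₀ ht₀).continuousAt hs).norm).eventually_lt_const
      (by simp [K]))
  obtain ⟨δ, hδ, hball⟩ := Metric.eventually_nhds_iff.1 hev
  have hK : 0 < K := by positivity
  -- A window of radius `1/(4K)` has length `1/(2K)`, the time `exists_linearODE_solution` admits,
  -- whatever the initial vector.
  refine ⟨min δ (1 / (4 * K)), by positivity, fun a b ha hab hb x ↦ ?_⟩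
  have hm1 := min_le_left δ (1 / (4 * K))
  have hm2 := min_le_right δ (1 / (4 * K))
  have hsub : ∀ t ∈ Icc a b, t ∈ s ∧ ‖A t‖ < K := by
    intro t ht
    apply hball
    rw [Real.dist_eq, abs_lt]
    constructor <;> linarith [ht.1, ht.2]
  have hKab : K * (b - a) ≤ 1 / 2 := by
    have h1 : b - a ≤ 2 * (1 / (4 * K)) := by linarith
    calc K * (b - a) ≤ K * (2 * (1 / (4 * K))) := by gcongr
      _ = 1 / 2 := by field_simp; norm_num
  obtain ⟨ξ, hξa, hξ⟩ := exists_linearODE_solution hab (hA.mono fun t ht ↦ (hsub t ht).1)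
    (fun t ht ↦ (hsub t ht).2.le) hKab x
  refine ⟨ξ, hξa, fun t ht ↦ ⟨_, hξ t ht, ?_⟩⟩
  rw [← hAdef]
  exact parallelEq_christoffelEnd (hinv (c t) (hcU (hsub t ht).1)) _ _

end Calculus

/-! ### Change of charts, parallel fields and parallel transport on `M`. -/

section Transport

open Filter Topology Set

variable {E : Type*} [NormedAddCommGroup E] [NormedSpace ℝ E]
  {M : Type*} [TopologicalSpace M] [ChartedSpace E M] [IsManifold 𝓘(ℝ, E) ∞ M]

theorem contDiffAt_chart_transition {x₀ x₁ x : M} (h₀ : x ∈ (extChartAt 𝓘(ℝ, E) x₀).source)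
    (h₁ : x ∈ (extChartAt 𝓘(ℝ, E) x₁).source) :
    ContDiffAt ℝ 2 (extChartAt 𝓘(ℝ, E) x₁ ∘ (extChartAt 𝓘(ℝ, E) x₀).symm)
      (extChartAt 𝓘(ℝ, E) x₀ x) := by
  have h := contDiffWithinAt_ext_coord_change (I := 𝓘(ℝ, E)) (n := ∞) x₁ x₀
    (y := extChartAt 𝓘(ℝ, E) x₀ x) (by
      rw [PartialEquiv.trans_source]
      refine ⟨(extChartAt 𝓘(ℝ, E) x₀).map_source h₀, ?_⟩
      rw [mem_preimage, (extChartAt 𝓘(ℝ, E) x₀).left_inv h₀]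
      exact h₁)
  have hr : range (𝓘(ℝ, E) : E → E) = univ := by simp
  rw [hr, contDiffWithinAt_univ] at h
  exact h.of_le (by norm_cast)

theorem hasMFDerivAt_chart {x₀ x : M} (h₀ : x ∈ (extChartAt 𝓘(ℝ, E) x₀).source) :
    HasMFDerivAt 𝓘(ℝ, E) 𝓘(ℝ, E) (extChartAt 𝓘(ℝ, E) x₀) x
      (mfderiv 𝓘(ℝ, E) 𝓘(ℝ, E) (extChartAt 𝓘(ℝ, E) x₀) x) :=
  (mdifferentiableAt_extChartAt (by rwa [extChartAt_source] at h₀)).hasMFDerivAt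

theorem coords_eq_fderiv_transition {x₀ x₁ x : M} (h₀ : x ∈ (extChartAt 𝓘(ℝ, E) x₀).source)
    (h₁ : x ∈ (extChartAt 𝓘(ℝ, E) x₁).source) (v : TangentSpace 𝓘(ℝ, E) x) :
    coords x₁ x v =
      fderiv ℝ (extChartAt 𝓘(ℝ, E) x₁ ∘ (extChartAt 𝓘(ℝ, E) x₀).symm)
        (extChartAt 𝓘(ℝ, E) x₀ x) (coords x₀ x v) := by
  have hφ : HasMFDerivAt 𝓘(ℝ, E) 𝓘(ℝ, E)
      (extChartAt 𝓘(ℝ, E) x₁ ∘ (extChartAt 𝓘(ℝ, E) x₀).symm) (extChartAt 𝓘(ℝ, E) x₀ x) _ :=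
    ((contDiffAt_chart_transition h₀ h₁).differentiableAt (by simp)).hasFDerivAt.hasMFDerivAt
  have h2 := hφ.comp x (hasMFDerivAt_chart h₀)
  have h3 : (extChartAt 𝓘(ℝ, E) x₁ : M → E) =ᶠ[𝓝 x]
      (extChartAt 𝓘(ℝ, E) x₁ ∘ (extChartAt 𝓘(ℝ, E) x₀).symm) ∘ extChartAt 𝓘(ℝ, E) x₀ := by
    filter_upwards [(isOpen_extChartAt_source x₀).mem_nhds h₀] with z hz
    simp only [Function.comp, (extChartAt 𝓘(ℝ, E) x₀).left_inv hz]
  have h4 := hasMFDerivAt_unique (hasMFDerivAt_chart h₁) (h2.congr_of_eventuallyEq h3)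
  exact DFunLike.congr_fun h4 v

theorem surjective_fderiv_transition {x₀ x₁ x : M} (h₀ : x ∈ (extChartAt 𝓘(ℝ, E) x₀).source)
    (h₁ : x ∈ (extChartAt 𝓘(ℝ, E) x₁).source) :
    Function.Surjective (fderiv ℝ (extChartAt 𝓘(ℝ, E) x₁ ∘ (extChartAt 𝓘(ℝ, E) x₀).symm)
        (extChartAt 𝓘(ℝ, E) x₀ x)) := fun u ↦
  ⟨coords x₀ x (mfderiv 𝓘(ℝ, E) 𝓘(ℝ, E) (extChartAt 𝓘(ℝ, E) x₁).symm
      (extChartAt 𝓘(ℝ, E) x₁ x) u : E), 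
    (coords_eq_fderiv_transition h₀ h₁ _).symm.trans (coords_mfderiv_chart_symm h₁ u)⟩

theorem hasDerivAt_chart_comp {γ : ℝ → M} {t : ℝ} (hγ : MDifferentiableAt 𝓘(ℝ, ℝ) 𝓘(ℝ, E) γ t)
    {x₀ : M} (h₀ : γ t ∈ (extChartAt 𝓘(ℝ, E) x₀).source) :
    HasDerivAt (fun r ↦ extChartAt 𝓘(ℝ, E) x₀ (γ r)) (coords x₀ (γ t) (velocity γ t)) t := by
  have h : HasFDerivAt (𝕜 := ℝ) (E := ℝ) (F := E) (fun r ↦ extChartAt 𝓘(ℝ, E) x₀ (γ r)) _ t :=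
    hasMFDerivAt_iff_hasFDerivAt.1 ((hasMFDerivAt_chart h₀).comp t hγ.hasMFDerivAt)
  exact hasFDerivAt_iff_hasDerivAt.1 h

theorem contDiffOn_chart_comp {γ : ℝ → M} (hγ : ContMDiff 𝓘(ℝ, ℝ) 𝓘(ℝ, E) ∞ γ) (x₀ : M) :
    ContDiffOn ℝ ∞ (fun r ↦ extChartAt 𝓘(ℝ, E) x₀ (γ r))
      (γ ⁻¹' (extChartAt 𝓘(ℝ, E) x₀).source) := by
  rw [← contMDiffOn_iff_contDiffOn]
  exact (contMDiffOn_extChartAt (x := x₀)).comp hγ.contMDiffOn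
    fun t ht ↦ by rwa [mem_preimage, extChartAt_source] at ht

variable [RiemannianBundle (fun x : M ↦ TangentSpace 𝓘(ℝ, E) x)]

theorem metricForm_eq_transition {x₀ x₁ x : M} (h₀ : x ∈ (extChartAt 𝓘(ℝ, E) x₀).source)
    (h₁ : x ∈ (extChartAt 𝓘(ℝ, E) x₁).source) :
    ∀ᶠ y in 𝓝 (extChartAt 𝓘(ℝ, E) x₀ x), ∀ u w, metricForm x₀ y u w =
      metricForm x₁ ((extChartAt 𝓘(ℝ, E) x₁ ∘ (extChartAt 𝓘(ℝ, E) x₀).symm) y)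
        (fderiv ℝ (extChartAt 𝓘(ℝ, E) x₁ ∘ (extChartAt 𝓘(ℝ, E) x₀).symm) y u)
        (fderiv ℝ (extChartAt 𝓘(ℝ, E) x₁ ∘ (extChartAt 𝓘(ℝ, E) x₀).symm) y w) := by
  have hcont : ContinuousAt (extChartAt 𝓘(ℝ, E) x₀).symm (extChartAt 𝓘(ℝ, E) x₀ x) :=
    continuousAt_extChartAt_symm' h₀
  have hx := (extChartAt 𝓘(ℝ, E) x₀).left_inv h₀
  filter_upwards [(isOpen_extChartAt_target x₀).mem_nhds ((extChartAt 𝓘(ℝ, E) x₀).map_source h₀),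
    hcont.preimage_mem_nhds (by rw [hx]; exact (isOpen_extChartAt_source x₁).mem_nhds h₁)]
    with y hy hy1 u w
  have hy0 := (extChartAt 𝓘(ℝ, E) x₀).map_target hy
  obtain ⟨z, hz, rfl⟩ : ∃ z ∈ (extChartAt 𝓘(ℝ, E) x₀).source, extChartAt 𝓘(ℝ, E) x₀ z = y :=
    ⟨_, hy0, (extChartAt 𝓘(ℝ, E) x₀).right_inv hy⟩
  rw [mem_preimage, (extChartAt 𝓘(ℝ, E) x₀).left_inv hz] at hy1
  set u' : TangentSpace 𝓘(ℝ, E) z := (mfderiv 𝓘(ℝ, E) 𝓘(ℝ, E) (extChartAt 𝓘(ℝ, E) x₀).symm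
      (extChartAt 𝓘(ℝ, E) x₀ z) u : E) with hu'
  set w' : TangentSpace 𝓘(ℝ, E) z := (mfderiv 𝓘(ℝ, E) 𝓘(ℝ, E) (extChartAt 𝓘(ℝ, E) x₀).symm
      (extChartAt 𝓘(ℝ, E) x₀ z) w : E) with hw'
  have hu : coords x₀ z u' = u := coords_mfderiv_chart_symm hz u
  have hw : coords x₀ z w' = w := coords_mfderiv_chart_symm hz w
  rw [← hu, ← hw, ← inner_eq_metricForm hz, ← coords_eq_fderiv_transition hz hy1,
    ← coords_eq_fderiv_transition hz hy1, Function.comp, (extChartAt 𝓘(ℝ, E) x₀).left_inv hz,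
    ← inner_eq_metricForm hy1]

variable [FiniteDimensional ℝ E]
  [IsContMDiffRiemannianBundle 𝓘(ℝ, E) ∞ E (fun x : M ↦ TangentSpace 𝓘(ℝ, E) x)]

theorem differentiableAt_metricForm {x₀ : M} {y : E}
    (hy : y ∈ (extChartAt 𝓘(ℝ, E) x₀).target) :
    DifferentiableAt ℝ (metricForm (E := E) x₀) y :=
  ((contDiffOn_metricForm x₀).contDiffAt ((isOpen_extChartAt_target x₀).mem_nhds hy)
    ).differentiableAt (by simp)

theorem fderiv_chartMetric {x₀ : M} {y : E} (hy : y ∈ (extChartAt 𝓘(ℝ, E) x₀).target)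
    (u v w : E) :
    fderiv ℝ (fun z ↦ chartMetric x₀ z v w) y u = fderiv ℝ (metricForm x₀) y u v w := by
  have h := ((differentiableAt_metricForm hy).hasFDerivAt.clm_apply
    (hasFDerivAt_const v y)).clm_apply (hasFDerivAt_const w y)
  have h' : HasFDerivAt (fun z ↦ chartMetric x₀ z v w) _ y := h
  rw [h'.fderiv]
  simp

theorem christoffel_eq {x₀ : M} {y : E} (hy : y ∈ (extChartAt 𝓘(ℝ, E) x₀).target) (u v w : E) :
    christoffel x₀ y u v w = christoffelForm (metricForm x₀) y u v w := by
  simp only [christoffel, christoffelForm, fderiv_chartMetric hy]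

theorem isParallelOn_iff (γ : ℝ → M) (V : (t : ℝ) → TangentSpace 𝓘(ℝ, E) (γ t)) (s : Set ℝ) :
    IsParallelOn γ V s ↔ ∀ t ∈ s, ∀ x₀ : M, γ t ∈ (extChartAt 𝓘(ℝ, E) x₀).source →
      ∃ ξ' : E, HasDerivWithinAt (fun r ↦ coords x₀ (γ r) (V r)) ξ' s t ∧
        ParallelEq (metricForm x₀) (extChartAt 𝓘(ℝ, E) x₀ (γ t))
          (coords x₀ (γ t) (velocity γ t)) (coords x₀ (γ t) (V t)) ξ' := by
  refine forall₂_congr fun t ht ↦ forall₂_congr fun x₀ hx₀ ↦ exists_congr fun ξ' ↦ ?_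
  refine and_congr_right fun _ ↦ forall_congr' fun w ↦ ?_
  rw [christoffel_eq ((extChartAt 𝓘(ℝ, E) x₀).map_source hx₀), metricForm_apply]

omit [IsManifold 𝓘(ℝ, E) ∞ M] [FiniteDimensional ℝ E]
  [IsContMDiffRiemannianBundle 𝓘(ℝ, E) ∞ E (fun x : M ↦ TangentSpace 𝓘(ℝ, E) x)] in
theorem IsParallelOn.mono {γ : ℝ → M} {V : (t : ℝ) → TangentSpace 𝓘(ℝ, E) (γ t)} {s s' : Set ℝ}
    (h : IsParallelOn γ V s) (hs : s' ⊆ s) : IsParallelOn γ V s' := fun t ht x₀ hx₀ ↦ by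
  obtain ⟨ξ', h1, h2⟩ := h t (hs ht) x₀ hx₀
  exact ⟨ξ', h1.mono hs, h2⟩

theorem IsParallelOn.hasDerivWithinAt_inner {γ : ℝ → M} (hγ : ContMDiff 𝓘(ℝ, ℝ) 𝓘(ℝ, E) ∞ γ)
    {V W : (t : ℝ) → TangentSpace 𝓘(ℝ, E) (γ t)} {s : Set ℝ} (hV : IsParallelOn γ V s)
    (hW : IsParallelOn γ W s) {t : ℝ} (ht : t ∈ s) :
    HasDerivWithinAt (fun r ↦ (inner ℝ (V r) (W r) : ℝ)) 0 s t := by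
  have hx₀ : γ t ∈ (extChartAt 𝓘(ℝ, E) (γ t)).source := mem_extChartAt_source (γ t)
  obtain ⟨ξ', hξ, hξe⟩ := (isParallelOn_iff γ V s).1 hV t ht (γ t) hx₀
  obtain ⟨η', hη, hηe⟩ := (isParallelOn_iff γ W s).1 hW t ht (γ t) hx₀
  have hc := (hasDerivAt_chart_comp ((hγ t).mdifferentiableAt (by simp)) hx₀).hasDerivWithinAt
    (s := s)
  have h := ParallelEq.hasDerivWithinAt_bilin
    (differentiableAt_metricForm ((extChartAt 𝓘(ℝ, E) (γ t)).map_source hx₀))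
    (metricForm_symm (γ t)) hc hξ hη hξe hηe
  refine h.congr_of_eventuallyEq ?_ (inner_eq_metricForm hx₀ _ _)
  have : ∀ᶠ r in 𝓝 t, γ r ∈ (extChartAt 𝓘(ℝ, E) (γ t)).source :=
    hγ.continuous.continuousAt.preimage_mem_nhds ((isOpen_extChartAt_source (γ t)).mem_nhds hx₀)
  filter_upwards [nhdsWithin_le_nhds this] with r hr
  exact inner_eq_metricForm hr _ _

theorem IsParallelOn.inner_eq {γ : ℝ → M} (hγ : ContMDiff 𝓘(ℝ, ℝ) 𝓘(ℝ, E) ∞ γ)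
    {V W : (t : ℝ) → TangentSpace 𝓘(ℝ, E) (γ t)} {a b : ℝ} (hab : a ≤ b)
    (hV : IsParallelOn γ V (Icc a b)) (hW : IsParallelOn γ W (Icc a b)) :
    (inner ℝ (V b) (W b) : ℝ) = inner ℝ (V a) (W a) := by
  have h := fun t ht ↦ hV.hasDerivWithinAt_inner hγ hW (t := t) ht
  refine constant_of_has_deriv_right_zero (f := fun r ↦ (inner ℝ (V r) (W r) : ℝ))
    (fun t ht ↦ (h t ht).continuousWithinAt)
    (fun t ht ↦ ?_) b (right_mem_Icc.2 hab)
  exact (h t ⟨ht.1, ht.2.le⟩).mono_of_mem_nhdsWithin (Icc_mem_nhdsGE_of_mem ht)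

/-- The equation is solved in the chart at `γ t₀` and pushed to every other chart by
`ParallelEq.pushforward`, since `IsParallelOn` quantifies over all charts. -/
theorem exists_isParallelOn_nhds {γ : ℝ → M} (hγ : ContMDiff 𝓘(ℝ, ℝ) 𝓘(ℝ, E) ∞ γ) (t₀ : ℝ) :
    ∃ δ > 0, ∀ a b, t₀ - δ < a → a ≤ b → b < t₀ + δ → ∀ v : TangentSpace 𝓘(ℝ, E) (γ a),
      ∃ V : (t : ℝ) → TangentSpace 𝓘(ℝ, E) (γ t), IsParallelOn γ V (Icc a b) ∧ V a = v := by
  set x₀ := γ t₀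
  have hx₀ : γ t₀ ∈ (extChartAt 𝓘(ℝ, E) x₀).source := mem_extChartAt_source (γ t₀)
  have hSo : IsOpen (γ ⁻¹' (extChartAt 𝓘(ℝ, E) x₀).source) :=
    (isOpen_extChartAt_source x₀).preimage hγ.continuous
  obtain ⟨ρ, hρ, hball⟩ := Metric.isOpen_iff.1 hSo t₀ hx₀
  have hcd := contDiffOn_chart_comp hγ x₀
  have hdc (t : ℝ) (ht : t ∈ γ ⁻¹' (extChartAt 𝓘(ℝ, E) x₀).source) :=
    hasDerivAt_chart_comp ((hγ t).mdifferentiableAt (by simp)) (x₀ := x₀) ht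
  have hc' : ContinuousOn (fun t ↦ coords x₀ (γ t) (velocity γ t))
      (γ ⁻¹' (extChartAt 𝓘(ℝ, E) x₀).source) :=
    (hcd.continuousOn_deriv_of_isOpen hSo (by simp)).congr fun t ht ↦ (hdc t ht).deriv.symm
  obtain ⟨δ, hδ, hex⟩ := exists_local_parallel (isOpen_extChartAt_target x₀)
    ((contDiffOn_metricForm x₀).of_le (by simp)) (fun y hy ↦ isInvertible_metricForm hy)
    (hSo.mem_nhds hx₀) (fun t ht ↦ (extChartAt 𝓘(ℝ, E) x₀).map_source ht)
    hcd.continuousOn hc'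
  refine ⟨min δ ρ, lt_min hδ hρ, fun a b ha hab hb v ↦ ?_⟩
  have hm1 := min_le_left δ ρ
  have hm2 := min_le_right δ ρ
  have hsrc : ∀ t ∈ Icc a b, γ t ∈ (extChartAt 𝓘(ℝ, E) x₀).source := fun t ht ↦ by
    apply hball
    rw [Metric.mem_ball, Real.dist_eq, abs_lt]
    constructor <;> linarith [ht.1, ht.2]
  obtain ⟨ξ, hξa, hξ⟩ := hex a b (by linarith) hab (by linarith) (coords x₀ (γ a) v)
  let V : (t : ℝ) → TangentSpace 𝓘(ℝ, E) (γ t) := fun t ↦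
    (mfderiv 𝓘(ℝ, E) 𝓘(ℝ, E) (extChartAt 𝓘(ℝ, E) x₀).symm (extChartAt 𝓘(ℝ, E) x₀ (γ t)) (ξ t) : E)
  have hVξ : ∀ t ∈ Icc a b, coords x₀ (γ t) (V t) = ξ t := fun t ht ↦
    coords_mfderiv_chart_symm (hsrc t ht) (ξ t)
  refine ⟨V, (isParallelOn_iff γ V _).2 fun t ht x₁ hx₁ ↦ ?_, ?_⟩
  · obtain ⟨ξ', hξ', hpar⟩ := hξ t ht
    have hφ := contDiffAt_chart_transition (hsrc t ht) hx₁
    have hcoord : ∀ r ∈ Icc a b, γ r ∈ (extChartAt 𝓘(ℝ, E) x₁).source →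
        coords x₁ (γ r) (V r) = fderiv ℝ
          (extChartAt 𝓘(ℝ, E) x₁ ∘ (extChartAt 𝓘(ℝ, E) x₀).symm)
          (extChartAt 𝓘(ℝ, E) x₀ (γ r)) (ξ r) := fun r hr hr1 ↦ by
      rw [coords_eq_fderiv_transition (hsrc r hr) hr1, hVξ r hr]
    refine ⟨_, (hasDerivWithinAt_pushforward hφ
      (hdc t (hsrc t ht)).hasDerivWithinAt hξ').congr_of_eventuallyEq ?_ (hcoord t ht hx₁), ?_⟩
    · have : ∀ᶠ r in 𝓝 t, γ r ∈ (extChartAt 𝓘(ℝ, E) x₁).source :=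
        hγ.continuous.continuousAt.preimage_mem_nhds ((isOpen_extChartAt_source x₁).mem_nhds hx₁)
      filter_upwards [nhdsWithin_le_nhds this, self_mem_nhdsWithin] with r hr hr'
      exact hcoord r hr' hr
    · have hx := (extChartAt 𝓘(ℝ, E) x₀).left_inv (hsrc t ht)
      have h := hpar.pushforward
        (φ := extChartAt 𝓘(ℝ, E) x₁ ∘ (extChartAt 𝓘(ℝ, E) x₀).symm) (H := metricForm x₁)
        (differentiableAt_metricForm ((extChartAt 𝓘(ℝ, E) x₀).map_source (hsrc t ht)))
        (differentiableAt_metricForm (by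
          rw [Function.comp, hx]; exact (extChartAt 𝓘(ℝ, E) x₁).map_source hx₁))
        hφ (metricForm_symm x₁) (metricForm_eq_transition (hsrc t ht) hx₁)
        (surjective_fderiv_transition (hsrc t ht) hx₁)
      rw [hcoord t ht hx₁, coords_eq_fderiv_transition (hsrc t ht) hx₁]
      have hφt : (extChartAt 𝓘(ℝ, E) x₁ ∘ (extChartAt 𝓘(ℝ, E) x₀).symm)
          (extChartAt 𝓘(ℝ, E) x₀ (γ t)) = extChartAt 𝓘(ℝ, E) x₁ (γ t) := by
        rw [Function.comp, hx]
      rwa [hφt] at h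
  · have h1 := mfderiv_chart_symm_coords (hsrc a (left_mem_Icc.2 hab)) v
    rw [← hξa] at h1
    exact h1

/-- Uniqueness of parallel fields is not needed: whichever field is chosen, its inner product with
`γ'` is constant. The hypothesis `h` excludes the default value `0`. -/
theorem inner_parallelTransport {γ : ℝ → M} (hγ : IsGeodesic (E := E) γ) {a b : ℝ} (hab : a ≤ b)
    {v : TangentSpace 𝓘(ℝ, E) (γ a)}
    (h : ∃ V : (t : ℝ) → TangentSpace 𝓘(ℝ, E) (γ t), IsParallelOn γ V (Icc a b) ∧ V a = v) :
    (inner ℝ (parallelTransport γ a b v) (velocity γ b) : ℝ) = inner ℝ v (velocity γ a) := by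
  rw [parallelTransport, dif_pos h]
  have h1 := IsParallelOn.inner_eq hγ.1 hab h.choose_spec.1 (hγ.2.mono (subset_univ _))
  rw [h1, h.choose_spec.2]

theorem IsGeodesic.norm_velocity_eq {γ : ℝ → M} (hγ : IsGeodesic (E := E) γ) (a b : ℝ) :
    ‖velocity (E := E) γ a‖ = ‖velocity (E := E) γ b‖ := by
  wlog hab : a ≤ b generalizing a b
  · exact (this b a (le_of_not_ge hab)).symm
  have h := hγ.2.mono (subset_univ (Icc a b))
  rw [norm_eq_sqrt_real_inner, norm_eq_sqrt_real_inner, h.inner_eq hγ.1 hab h]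

end Transport

/-! ### One-variable comparison inequalities. -/

section RealCalculus

open Filter Topology Set

/-- The mean value inequality with right slopes sees only short intervals, so no derivative of `ψ`
and no uniform `δ` are needed. -/
theorem le_add_mul_of_locally_lipschitz {ψ : ℝ → ℝ} {C : ℝ}
    (h : ∀ t₀, ∃ δ > 0, ∀ a b, t₀ - δ < a → a ≤ b → b < t₀ + δ → |ψ b - ψ a| ≤ C * (b - a))
    {t : ℝ} (ht : 0 ≤ t) : ψ t ≤ ψ 0 + C * t := by
  have hcont : Continuous ψ := by
    rw [continuous_iff_continuousAt]
    intro t₀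
    obtain ⟨δ, hδ, hab⟩ := h t₀
    have hlim : Tendsto (fun r ↦ C * |r - t₀|) (𝓝 t₀) (𝓝 0) := by
      have : Continuous fun r ↦ C * |r - t₀| := by fun_prop
      simpa using this.tendsto t₀
    rw [ContinuousAt, tendsto_iff_norm_sub_tendsto_zero]
    refine squeeze_zero' (Eventually.of_forall fun _ ↦ norm_nonneg _) ?_ hlim
    filter_upwards [Ioo_mem_nhds (by linarith : t₀ - δ < t₀) (by linarith : t₀ < t₀ + δ)]
      with r hr
    rw [Real.norm_eq_abs]
    rcases le_total r t₀ with hrt | hrt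
    · rw [abs_sub_comm, abs_of_nonpos (sub_nonpos.2 hrt), neg_sub]
      exact hab r t₀ hr.1 hrt (by linarith)
    · rw [abs_of_nonneg (sub_nonneg.2 hrt)]
      exact hab t₀ r (by linarith) hrt hr.2
  refine image_le_of_liminf_slope_right_le_deriv_boundary (f := ψ) (a := 0) (b := t)
    (B := fun r ↦ ψ 0 + C * r) (B' := fun _ ↦ C) hcont.continuousOn (by simp) (by fun_prop)
    (fun x _ ↦ ?_) (fun x _ r hr ↦ ?_) (right_mem_Icc.2 ht)
  · simpa using (((hasDerivAt_id x).const_mul C).const_add (ψ 0)).hasDerivWithinAt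
  · obtain ⟨δ, hδ, hab⟩ := h x
    refine Eventually.frequently ?_
    filter_upwards [Ioo_mem_nhdsGT (by linarith : x < x + δ)] with z hz
    rw [slope_def_field, div_lt_iff₀ (by linarith [hz.1])]
    have h1 := (le_abs_self _).trans (hab x z (by linarith) hz.1.le hz.2)
    have h2 : C * (z - x) < r * (z - x) := mul_lt_mul_of_pos_right hr (by linarith [hz.1])
    linarith

/-- Comparing `φ` with a quadratic, instead of integrating `ψ`, avoids any integrability
requirement. -/
theorem le_quadratic_of_deriv_le {φ ψ : ℝ → ℝ} {C : ℝ} (hφ : ∀ t, HasDerivAt φ (ψ t) t)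
    (hψ : ∀ t, 0 ≤ t → ψ t ≤ ψ 0 + C * t) : φ 1 ≤ φ 0 + ψ 0 + C / 2 := by
  have h := image_le_of_deriv_right_le_deriv_boundary (f := φ) (f' := ψ) (a := 0) (b := 1)
    (B := fun t ↦ φ 0 + (ψ 0 * t + C / 2 * t ^ 2)) (B' := fun t ↦ ψ 0 + C * t)
    (fun t _ ↦ (hφ t).continuousAt.continuousWithinAt) (fun t _ ↦ (hφ t).hasDerivWithinAt)
    (by simp) (by fun_prop) (fun t _ ↦ ?_) (fun t ht ↦ hψ t ht.1)
    (right_mem_Icc.2 zero_le_one)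
  · simpa [add_assoc] using h
  · have h1 := (((hasDerivAt_id t).const_mul (ψ 0)).add
      ((hasDerivAt_pow 2 t).const_mul (C / 2))).const_add (φ 0)
    refine HasDerivAt.hasDerivWithinAt ?_
    convert! h1 using 1
    norm_num
    ring

end RealCalculus

/-! ### The descent inequality along geodesics. -/

section Descent

open Set MeasureTheory

variable {E : Type*} [NormedAddCommGroup E] [NormedSpace ℝ E] [FiniteDimensional ℝ E]
  {M : Type*} [MetricSpace M] [ChartedSpace E M] [IsManifold 𝓘(ℝ, E) ∞ M]
  [RiemannianBundle (fun x : M ↦ TangentSpace 𝓘(ℝ, E) x)]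
  [IsContMDiffRiemannianBundle 𝓘(ℝ, E) ∞ E (fun x : M ↦ TangentSpace 𝓘(ℝ, E) x)]

/-- The right-hand side is the length of a constant-speed curve, and the distance is an infimum of
lengths. -/
theorem IsGeodesic.dist_le [IsRiemannianManifold 𝓘(ℝ, E) M] {γ : ℝ → M}
    (hγ : IsGeodesic (E := E) γ) {a b : ℝ} (hab : a ≤ b) :
    dist (γ a) (γ b) ≤ ‖velocity (E := E) γ 0‖ * (b - a) := by
  have h1 : edist (γ a) (γ b) ≤ Manifold.pathELength 𝓘(ℝ, E) γ a b := by
    rw [IsRiemannianManifold.out (I := 𝓘(ℝ, E)) (γ a) (γ b)]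
    exact Manifold.riemannianEDist_le_pathELength ((hγ.1.of_le (by simp)).contMDiffOn) rfl rfl hab
  rw [Manifold.pathELength_eq_lintegral_mfderiv_Icc] at h1
  have h2 : ∀ t : ℝ, ‖mfderiv 𝓘(ℝ, ℝ) 𝓘(ℝ, E) γ t (1 : ℝ)‖ₑ
      = ENNReal.ofReal ‖velocity (E := E) γ 0‖ := fun t ↦ by
    rw [← ofReal_norm]
    exact congrArg ENNReal.ofReal (hγ.norm_velocity_eq t 0)
  have h3 : ∫⁻ t in Icc a b, ‖mfderiv 𝓘(ℝ, ℝ) 𝓘(ℝ, E) γ t (1 : ℝ)‖ₑ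
      = ENNReal.ofReal (‖velocity (E := E) γ 0‖ * (b - a)) := by
    rw [lintegral_congr h2, setLIntegral_const, Real.volume_Icc,
      ← ENNReal.ofReal_mul (norm_nonneg _)]
  have h4 := h1.trans_eq h3
  rw [edist_dist] at h4
  exact (ENNReal.ofReal_le_ofReal_iff
    (mul_nonneg (norm_nonneg _) (sub_nonneg.2 hab))).1 h4

omit [IsManifold 𝓘(ℝ, E) ∞ M]
  [IsContMDiffRiemannianBundle 𝓘(ℝ, E) ∞ E (fun x : M ↦ TangentSpace 𝓘(ℝ, E) x)] in
theorem hasDerivAt_comp_curve {f : M → ℝ} (hf : MDifferentiable 𝓘(ℝ, E) 𝓘(ℝ, ℝ) f) {γ : ℝ → M}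
    (hγ : ContMDiff 𝓘(ℝ, ℝ) 𝓘(ℝ, E) ∞ γ) (t : ℝ) :
    HasDerivAt (fun r ↦ f (γ r)) (inner ℝ (grad (E := E) f (γ t)) (velocity γ t)) t := by
  have h : HasFDerivAt (𝕜 := ℝ) (E := ℝ) (F := ℝ) (fun r ↦ f (γ r)) _ t :=
    hasMFDerivAt_iff_hasFDerivAt.1
      ((hf (γ t)).hasMFDerivAt.comp t ((hγ t).mdifferentiableAt (by simp)).hasMFDerivAt)
  rw [inner_grad]
  exact hasFDerivAt_iff_hasDerivAt.1 h

theorem IsGeodesic.abs_inner_grad_sub_le [IsRiemannianManifold 𝓘(ℝ, E) M] {γ : ℝ → M}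
    (hγ : IsGeodesic (E := E) γ) {f : M → ℝ} {L : ℝ} (hL : 0 ≤ L)
    (hfL : HasLipschitzGradient E f L) {a b : ℝ} (hab : a ≤ b)
    (h : ∃ V : (t : ℝ) → TangentSpace 𝓘(ℝ, E) (γ t),
      IsParallelOn γ V (Icc a b) ∧ V a = grad f (γ a)) :
    |inner ℝ (grad (E := E) f (γ b)) (velocity γ b) - inner ℝ (grad (E := E) f (γ a)) (velocity γ a)|
      ≤ L * ‖velocity (E := E) γ 0‖ ^ 2 * (b - a) := by
  rw [← inner_parallelTransport hγ hab h, ← inner_sub_left]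
  calc _ ≤ ‖grad (E := E) f (γ b) - parallelTransport γ a b (grad f (γ a))‖
        * ‖velocity (E := E) γ b‖ := abs_real_inner_le_norm _ _
    _ ≤ (L * (‖velocity (E := E) γ 0‖ * (b - a))) * ‖velocity (E := E) γ 0‖ := by
        rw [norm_sub_rev, hγ.norm_velocity_eq b 0]
        gcongr
        exact (hfL γ hγ a b hab).trans (mul_le_mul_of_nonneg_left (hγ.dist_le hab) hL)
    _ = _ := by ring

theorem IsGeodesic.descent [IsRiemannianManifold 𝓘(ℝ, E) M] {γ : ℝ → M}
    (hγ : IsGeodesic (E := E) γ) {f : M → ℝ} (hf : MDifferentiable 𝓘(ℝ, E) 𝓘(ℝ, ℝ) f)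
    {L : ℝ} (hL : 0 ≤ L) (hfL : HasLipschitzGradient E f L) :
    f (γ 1) ≤ f (γ 0) + inner ℝ (grad (E := E) f (γ 0)) (velocity γ 0)
      + L * ‖velocity (E := E) γ 0‖ ^ 2 / 2 := by
  refine le_quadratic_of_deriv_le (hasDerivAt_comp_curve hf hγ.1) fun t ht ↦
    le_add_mul_of_locally_lipschitz
      (ψ := fun t ↦ inner ℝ (grad (E := E) f (γ t)) (velocity γ t)) (fun t₀ ↦ ?_) ht
  obtain ⟨δ, hδ, h⟩ := exists_isParallelOn_nhds hγ.1 t₀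
  exact ⟨δ, hδ, fun a b ha hab hb ↦ hγ.abs_inner_grad_sub_le hL hfL hab (h a b ha hab hb _)⟩

theorem apply_expMap_le [IsRiemannianManifold 𝓘(ℝ, E) M] (hM : GeodesicallyComplete E M)
    {f : M → ℝ} (hf : MDifferentiable 𝓘(ℝ, E) 𝓘(ℝ, ℝ) f)
    {L : ℝ} (hL : 0 ≤ L) (hfL : HasLipschitzGradient E f L) (p : M)
    (v : TangentSpace 𝓘(ℝ, E) p) :
    f (expMap (E := E) p v) ≤ f p + inner ℝ (grad (E := E) f p) v + L * ‖v‖ ^ 2 / 2 := by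
  rw [expMap, dif_pos (hM p v)]
  obtain ⟨hγ, h0⟩ := (hM p v).choose_spec
  -- Applying one function on the tangent bundle to `h0` replaces base point and velocity together,
  -- without casts between fibres.
  have h1 := congrArg (fun z : TangentBundle 𝓘(ℝ, E) M ↦
    f z.1 + inner ℝ (grad (E := E) f z.1) z.2 + L * ‖z.2‖ ^ 2 / 2) h0
  exact (hγ.descent hf hL hfL).trans_eq h1

theorem gradient_step_le [IsRiemannianManifold 𝓘(ℝ, E) M] (hM : GeodesicallyComplete E M)
    {f : M → ℝ} (hf : MDifferentiable 𝓘(ℝ, E) 𝓘(ℝ, ℝ) f)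
    {L : ℝ} (hL : 0 < L) (hfL : HasLipschitzGradient E f L) (p : M) :
    ‖grad (E := E) f p‖ ^ 2 ≤
      2 * L * (f p - f (expMap (E := E) p (-(1 / L) • grad (E := E) f p))) := by
  have h := apply_expMap_le hM hf hL.le hfL p (-(1 / L) • grad (E := E) f p)
  rw [inner_smul_right, real_inner_self_eq_norm_sq, norm_smul, norm_neg, Real.norm_eq_abs,
    abs_of_pos (by positivity), mul_pow] at h
  have h2 : -(1 / L) * ‖grad (E := E) f p‖ ^ 2
      + L * ((1 / L) ^ 2 * ‖grad (E := E) f p‖ ^ 2) / 2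
      = -(‖grad (E := E) f p‖ ^ 2 / (2 * L)) := by
    field_simp
    ring
  have h3 : ‖grad (E := E) f p‖ ^ 2 / (2 * L) ≤
      f p - f (expMap (E := E) p (-(1 / L) • grad (E := E) f p)) := by linarith
  rwa [div_le_iff₀' (by positivity)] at h3

end Descent

/-! ### From summed decrease to rates. -/

section Rate

open Finset

theorem sum_sq_le_of_decrease {g F : ℕ → ℝ} {C m : ℝ} (hC : 0 ≤ C) (hm : ∀ k, m ≤ F k)
    (h : ∀ k, g k ^ 2 ≤ C * (F k - F (k + 1))) (n : ℕ) :
    ∑ k ∈ range n, g k ^ 2 ≤ C * (F 0 - m) := by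
  calc ∑ k ∈ range n, g k ^ 2 ≤ ∑ k ∈ range n, C * (F k - F (k + 1)) :=
        sum_le_sum fun k _ ↦ h k
    _ = C * (F 0 - F n) := by rw [← mul_sum, sum_range_sub']
    _ ≤ C * (F 0 - m) := by gcongr; exact hm n

theorem inf'_le_sqrt_div_sqrt {g : ℕ → ℝ} {B : ℝ} (hg : ∀ k, 0 ≤ g k)
    (h : ∀ n, ∑ k ∈ range n, g k ^ 2 ≤ B) (N : ℕ) :
    (range (N + 1)).inf' nonempty_range_add_one g ≤ √B / √((N : ℝ) + 1) := by
  set m := (range (N + 1)).inf' nonempty_range_add_one g with hm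
  have hm0 : 0 ≤ m := le_inf' _ _ fun k _ ↦ hg k
  have h1 : ((N : ℝ) + 1) * m ^ 2 ≤ B := by
    refine le_trans ?_ (h (N + 1))
    have := card_nsmul_le_sum (range (N + 1)) (fun k ↦ g k ^ 2) (m ^ 2)
      fun k hk ↦ pow_le_pow_left₀ hm0 (inf'_le g hk) 2
    simpa using this
  rw [← Real.sqrt_div' _ (by positivity)]
  refine Real.le_sqrt_of_sq_le ?_
  rw [le_div_iff₀ (by positivity)]
  linarith

theorem exists_isLeast_lt_of_sum_sq_le {g : ℕ → ℝ} {B ε : ℝ} (hε : 0 < ε)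
    (h : ∀ n, ∑ k ∈ range n, g k ^ 2 ≤ B) :
    ∃ N : ℕ, IsLeast {k : ℕ | g k < ε} N ∧ (N : ℝ) ≤ B / ε ^ 2 := by
  -- The sum runs over `k < n` only, so at the first index below `ε` it omits that index; the same
  -- bound shows that such an index exists.
  have key : ∀ n : ℕ, (∀ k < n, ε ≤ g k) → (n : ℝ) ≤ B / ε ^ 2 := fun n hn ↦ by
    rw [le_div_iff₀ (by positivity)]
    refine le_trans ?_ (h n)
    have := card_nsmul_le_sum (range n) (fun k ↦ g k ^ 2) (ε ^ 2)
      fun k hk ↦ pow_le_pow_left₀ hε.le (hn k (mem_range.1 hk)) 2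
    simpa using this
  have hex : ∃ k, g k < ε := by
    by_contra! hcon
    obtain ⟨n, hn⟩ := exists_nat_gt (B / ε ^ 2)
    exact absurd (key n fun k _ ↦ hcon k) (not_le.2 hn)
  classical
  exact ⟨Nat.find hex, ⟨Nat.find_spec hex, fun k hk ↦ Nat.find_min' hex hk⟩,
    key _ fun k hk ↦ not_lt.1 (Nat.find_min hex hk)⟩

end Rate

end RiemannianOpt

end

theorem theorem1
    {E : Type*} [NormedAddCommGroup E] [NormedSpace ℝ E] [FiniteDimensional ℝ E]
    {M : Type*} [MetricSpace M] [ConnectedSpace M] [ChartedSpace E M] [IsManifold 𝓘(ℝ, E) ∞ M]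
    [RiemannianBundle (fun x : M ↦ TangentSpace 𝓘(ℝ, E) x)]
    [IsContMDiffRiemannianBundle 𝓘(ℝ, E) ∞ E (fun x : M ↦ TangentSpace 𝓘(ℝ, E) x)]
    [IsRiemannianManifold 𝓘(ℝ, E) M]
    (hM : RiemannianOpt.GeodesicallyComplete E M)
    (f : M → ℝ) (hf : MDifferentiable 𝓘(ℝ, E) 𝓘(ℝ, ℝ) f)
    (fstar : ℝ) (hfstar : IsLeast (Set.range f) fstar)
    (L : ℝ) (hL : 0 < L) (hfL : RiemannianOpt.HasLipschitzGradient E f L)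
    (p : ℕ → M) (hp : RiemannianOpt.IsGradientSequence E f (fun _ ↦ 1 / L) p) :
    (∀ N : ℕ,
      (Finset.range (N + 1)).inf' Finset.nonempty_range_add_one
          (fun k ↦ ‖RiemannianOpt.grad (E := E) f (p k)‖)
        ≤ √(2 * L * (f (p 0) - fstar)) / √((N : ℝ) + 1)) ∧
    (∀ ε : ℝ, 0 < ε → ∃ N : ℕ,
      IsLeast {k : ℕ | ‖RiemannianOpt.grad (E := E) f (p k)‖ < ε} N ∧
        (N : ℝ) ≤ 2 * L * (f (p 0) - fstar) / ε ^ 2) := by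
  have hsum := RiemannianOpt.sum_sq_le_of_decrease (C := 2 * L)
    (g := fun k ↦ ‖RiemannianOpt.grad (E := E) f (p k)‖) (F := fun k ↦ f (p k)) (m := fstar)
    (by positivity) (fun k ↦ hfstar.2 (Set.mem_range_self (p k))) fun k ↦ by
      have h := RiemannianOpt.gradient_step_le hM hf hL hfL (p k)
      rwa [← (hp k).2] at h
  exact ⟨RiemannianOpt.inf'_le_sqrt_div_sqrt (fun k ↦ norm_nonneg _) hsum,
    fun ε hε ↦ RiemannianOpt.exists_isLeast_lt_of_sum_sq_le hε hsum⟩
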